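/- Define polynomials $Q_n=Q_n(x,y,z,t)\in\mathbb Z[x,y,z,t]$ for $n\ge 1$ by $$Q_1=1,\qquad Q_{n+1}=\bigl[x+nz+(y+t)(n+y\,\partial_y)\bigr]Q_n ,$$ and let $Q_{n,k}(x,t)\in\mathbb Z[x,t]$ be the coefficient of $y^k$ in $Q_n(x,y,1,t)$. A plane tree on $[m]=\{1,\dots,m\}$ is a rooted tree with vertex set $[m]$ in which the children of each vertex are linearly ordered from left to right. Every vertex is a descendant of itself, and $\beta_T(i)$ denotes the smallest descendant of the vertex $i$ in the plane tree $T$. A vertex $j$ is elder if it has a brother $k$ (another child of the same parent) to its right with $\beta_T(k)<\beta_T(j)$, and younger otherwise. Let $\mathrm{eld}(T)$ be the number of elder vertices of $T$, and $\mathrm{young}_T(v)$ the number of children of $v$ that are younger. An edge $(i,j)$, where $j$ is a child of $i$, is proper if $j$ is elder or $i<\beta_T(j)$, and improper otherwise. Let $\mathcal O_{m,k}$ be the set of plane trees on $[m]$ with root $1$ and exactly $k$ improper edges. Theorem. For all integers $n\ge 1$ and $k\ge 0$, every $T\in\mathcal O_{n+1,k}$ has $\mathrm{young}_T(1)\ge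 1$, and $$Q_{n,k}(x,t)=\sum_{T\in\mathcal O_{n+1,k}}x^{\mathrm{young}_T(1)-1}\,t^{\mathrm{eld}(T)} .$$ -/

import Mathlib

/-- The polynomials `Q_n(x, y, z, t)`, with the variables `x, y, z, t` numbered `0, 1, 2, 3`:
`Q_1 = 1` and `Q_{n+1} = [x + n z + (y + t) (n + y ∂_y)] Q_n` for `n ≥ 1`.
(The sequence starts at `n = 1`; the value at `0` is a dummy.) -/
noncomputable def chapotonQ : ℕ → MvPolynomial (Fin 4) ℤ
  | 0 => 0
  | 1 => 1
  | n + 2 =>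
      (MvPolynomial.X 0 + ((n + 1 : ℕ) : MvPolynomial (Fin 4) ℤ) * MvPolynomial.X 2)
          * chapotonQ (n + 1)
        + (MvPolynomial.X 1 + MvPolynomial.X 3)
          * (((n + 1 : ℕ) : MvPolynomial (Fin 4) ℤ) * chapotonQ (n + 1)
            + MvPolynomial.X 1 * MvPolynomial.pderiv 1 (chapotonQ (n + 1)))

/-- `Q_n(x, y, 1, t)` as a polynomial in `y` with coefficients in `ℤ[x, t]`,
where `x` and `t` are the variables numbered `0` and `1`. -/
noncomputable def chapotonQy (n : ℕ) : Polynomial (MvPolynomial (Fin 2) ℤ) :=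
  MvPolynomial.aeval
    ![Polynomial.C (MvPolynomial.X 0), Polynomial.X, 1, Polynomial.C (MvPolynomial.X 1)]
    (chapotonQ n)

/-- `Q_{n,k}(x, t)`: the coefficient of `y ^ k` in `Q_n(x, y, 1, t)`. -/
noncomputable def chapotonQcoeff (n k : ℕ) : MvPolynomial (Fin 2) ℤ :=
  (chapotonQy n).coeff k

/-- A plane tree with vertex set `V`: a rooted tree, given by the list, from left to right, of the
children of each vertex. The root is nobody's child, no vertex has two parents or is listed twice,
and every vertex can be reached from the root. -/
@[ext]
structure PlaneTree (V : Type*) where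
  root : V
  children : V → List V
  nodup : ∀ v, (children v).Nodup
  root_notMem : ∀ v, root ∉ children v
  parent_unique : ∀ u v w, w ∈ children u → w ∈ children v → u = v
  reachable : ∀ v, Relation.ReflTransGen (fun a b => b ∈ children a) root v

namespace PlaneTree

theorem toData_injective (V : Type*) : Function.Injective
    (fun T : PlaneTree V =>
      ((T.root, fun v => ⟨T.children v, T.nodup v⟩) : V × (V → {l : List V // l.Nodup}))) := by
  intro S T h
  have h1 := congrArg Prod.fst h
  have h2 := congrArg Prod.snd h
  refine PlaneTree.ext h1 ?_
  funext v
  exact congrArg Subtype.val (congrFun h2 v)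

noncomputable instance instFintype (V : Type*) [Fintype V] [DecidableEq V] :
    Fintype (PlaneTree V) :=
  Fintype.ofInjective _ (toData_injective V)

/-- `j` is a descendant of `i` (every vertex is a descendant of itself). -/
def IsDescendant {V : Type*} (T : PlaneTree V) (i j : V) : Prop :=
  Relation.ReflTransGen (fun a b => b ∈ T.children a) i j

open Classical in
/-- The set of descendants of `i`. -/
noncomputable def descendants {V : Type*} [Fintype V] (T : PlaneTree V) (i : V) : Finset V :=
  Finset.univ.filter fun j => T.IsDescendant i j

theorem mem_descendants {V : Type*} [Fintype V] (T : PlaneTree V) (i j : V) :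
    j ∈ T.descendants i ↔ T.IsDescendant i j := by
  classical
  rw [descendants, Finset.mem_filter]
  exact and_iff_right (Finset.mem_univ j)

theorem descendants_nonempty {V : Type*} [Fintype V] (T : PlaneTree V) (i : V) :
    (T.descendants i).Nonempty :=
  ⟨i, (T.mem_descendants i i).2 Relation.ReflTransGen.refl⟩

/-- `β_T(i)`: the smallest descendant of `i`. -/
noncomputable def beta {V : Type*} [Fintype V] [LinearOrder V] (T : PlaneTree V) (i : V) : V :=
  (T.descendants i).min' (T.descendants_nonempty i)

/-- `j` is elder: it has a brother `k` to its right with `β_T(k) < β_T(j)`. -/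
def IsElder {V : Type*} [Fintype V] [LinearOrder V] (T : PlaneTree V) (j : V) : Prop :=
  ∃ v k, List.Sublist [j, k] (T.children v) ∧ T.beta k < T.beta j

/-- `(i, j)` is a proper edge: `j` is a child of `i`, and `j` is elder or `i < β_T(j)`. -/
def IsProperEdge {V : Type*} [Fintype V] [LinearOrder V] (T : PlaneTree V) (i j : V) : Prop :=
  j ∈ T.children i ∧ (T.IsElder j ∨ i < T.beta j)

/-- `(i, j)` is an improper edge: an edge that is not proper. -/
def IsImproperEdge {V : Type*} [Fintype V] [LinearOrder V] (T : PlaneTree V) (i j : V) : Prop :=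
  j ∈ T.children i ∧ ¬ T.IsProperEdge i j

/-- `deg_T(v)`: the number of children of `v`. -/
def deg {V : Type*} (T : PlaneTree V) (v : V) : ℕ := (T.children v).length

open Classical in
/-- `eld_T(v)`: the number of elder children of `v`. -/
noncomputable def eldAt {V : Type*} [Fintype V] [LinearOrder V] (T : PlaneTree V) (v : V) : ℕ :=
  (Finset.univ.filter fun j => j ∈ T.children v ∧ T.IsElder j).card

open Classical in
/-- `eld(T)`: the number of elder vertices of `T`. -/
noncomputable def eld {V : Type*} [Fintype V] [LinearOrder V] (T : PlaneTree V) : ℕ :=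
  (Finset.univ.filter fun j => T.IsElder j).card

/-- `young_T(v)`: the number of younger children of `v` (always `eld_T(v) ≤ deg_T(v)`). -/
noncomputable def young {V : Type*} [Fintype V] [LinearOrder V] (T : PlaneTree V) (v : V) : ℕ :=
  T.deg v - T.eldAt v

open Classical in
/-- The number of improper edges of `T`. -/
noncomputable def numImproper {V : Type*} [Fintype V] [LinearOrder V] (T : PlaneTree V) : ℕ :=
  (Finset.univ.filter fun e : V × V => T.IsImproperEdge e.1 e.2).card

end PlaneTree

open Classical in
/-- `O_{n,k}`: the plane trees on `[n]` with root `1` and exactly `k` improper edges. The vertex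
set `[n] = {1 < 2 < ... < n}` is modelled by `Fin n`, so that the vertex `1` is `0 : Fin n`. -/
noncomputable def planeTreesRootOne (n k : ℕ) : Finset (PlaneTree (Fin n)) :=
  Finset.univ.filter fun T => (T.root : ℕ) = 0 ∧ T.numImproper = k

/-! Remove the root 0 from a tree and keep the forest above it. Weight a vertex of the forest by t
if it is elder, by y if the edge to it is improper, and otherwise by x or 1 according to whether its
parent is the root. Edges at the smallest label are never improper, so the product of these weights
is t^eld y^(improper edges) x^young(root).

Let f be such a forest with n vertices and i improper edges, and insert a new largest label m. It
may become a leaf as the last child of the root or of any vertex (x + n in total), or a leaf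
immediately to the left of any vertex (elder: t each), or it may take the place of a vertex a, with
a as its only child (one new improper edge: y each). Moreover, for each improper edge from a to j, m
may take the place of a and receive as children the children of a up to j, together with a itself,
which keeps its later children and stands next to j. To the right of j, a adds an improper edge
(factor y); to the left, it is elder (factor t). No other weight changes. The total factor x + n +
n(y + t) + (y + t)i is the recurrence for Q_n, because y∂_y multiplies y^i by i (`sum_weight_ins`,
`X_mul_derivative_weight`).

Each forest arises exactly once: if m has several children, the last two are j and a in some order,
and a is the one whose subtree has the larger minimum (`del_of_mem_ins`, `mem_ins_del`,
`nodup_ins`). Since n = 1 gives x, the forests sum to x Q_n, and x cancels. -/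

/-- Plane forests with vertices labelled in `V`, encoded as binary trees: `node v kids sibs` is the
forest whose first tree has root `v`, above the forest `kids`, and whose other trees form `sibs`. -/
inductive PlaneForest (V : Type*) where
  | nil : PlaneForest V
  | node (v : V) (kids sibs : PlaneForest V) : PlaneForest V

/-! ### Labels, roots and smallest labels of forests -/

namespace PlaneForest

variable {V : Type*}

/-- The vertices of a forest, in preorder. -/
def labels : PlaneForest V → List V
  | nil => []
  | node a l r => a :: (labels l ++ labels r)

/-- The roots of a forest, from left to right. -/
def roots : PlaneForest V → List V
  | nil => []
  | node a _ r => a :: roots r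

theorem mem_labels_node {a b : V} {l r : PlaneForest V} :
    b ∈ (node a l r).labels ↔ b = a ∨ b ∈ l.labels ∨ b ∈ r.labels := by
  simp [labels]

theorem nodup_node {a : V} {l r : PlaneForest V} :
    (node a l r).labels.Nodup ↔ a ∉ l.labels ∧ a ∉ r.labels ∧ l.labels.Nodup ∧ r.labels.Nodup ∧
      l.labels.Disjoint r.labels := by
  simp only [labels, List.nodup_cons, List.mem_append, not_or, List.nodup_append']
  tauto

section Low

variable [LinearOrder V]

/-- The smallest label of a forest. -/
def low : PlaneForest V → WithTop V
  | nil => ⊤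
  | node a l r => min (min (a : WithTop V) (low l)) (low r)

/-- The smallest label of the tree with root `a` above the forest `l`. -/
def treeLow (a : V) (l : PlaneForest V) : WithTop V := min (a : WithTop V) (low l)

theorem low_node (a : V) (l r : PlaneForest V) : (node a l r).low = min (treeLow a l) r.low := rfl

theorem low_nil : (nil : PlaneForest V).low = ⊤ := rfl

theorem low_node_nil (a : V) (l : PlaneForest V) : (node a l nil).low = treeLow a l :=
  min_top_right _

theorem treeLow_le (a : V) (l : PlaneForest V) : treeLow a l ≤ a := min_le_left _ _

theorem exists_mem_low_eq (f : PlaneForest V) : f.low = ⊤ ∨ ∃ a ∈ f.labels, f.low = a := by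
  induction f with
  | nil => exact Or.inl rfl
  | node a l r ihl ihr =>
    right
    simp only [mem_labels_node, low]
    rcases min_choice (min (a : WithTop V) (low l)) (low r) with h | h
    · rcases min_choice (a : WithTop V) (low l) with h' | h'
      · exact ⟨a, Or.inl rfl, by rw [h, h']⟩
      · rcases ihl with h2 | ⟨b, hb, h2⟩
        · refine ⟨a, Or.inl rfl, ?_⟩
          rw [h, h2, min_top_right]
        · exact ⟨b, Or.inr (Or.inl hb), by rw [h, h', h2]⟩
    · rcases ihr with h2 | ⟨b, hb, h2⟩
      · rw [h2, min_eq_right_iff, top_le_iff] at h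
        exact absurd ((min_le_left _ _).trans_lt (WithTop.coe_lt_top a)) (by rw [h]; simp)
      · exact ⟨b, Or.inr (Or.inr hb), by rw [h, h2]⟩

theorem exists_mem_treeLow_eq (a : V) (l : PlaneForest V) :
    ∃ b, (b = a ∨ b ∈ l.labels) ∧ treeLow a l = b := by
  rcases min_choice (a : WithTop V) (low l) with h | h
  · exact ⟨a, Or.inl rfl, h⟩
  · rcases exists_mem_low_eq l with h' | ⟨b, hb, h'⟩
    · exact ⟨a, Or.inl rfl, by rw [treeLow, h', min_top_right]⟩
    · exact ⟨b, Or.inr hb, h.trans h'⟩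

theorem low_le_of_mem {f : PlaneForest V} {a : V} (h : a ∈ f.labels) : f.low ≤ a := by
  induction f with
  | nil => simp [labels] at h
  | node b l r ihl ihr =>
    rw [mem_labels_node] at h
    rcases h with rfl | h | h
    · exact (min_le_left _ _).trans (min_le_left _ _)
    · exact (min_le_left _ _).trans ((min_le_right _ _).trans (ihl h))
    · exact (min_le_right _ _).trans (ihr h)

/-- Distinct labels exclude ties: the tree of a younger root has a strictly smaller minimum than the
trees to its right. -/
theorem treeLow_ne_low {a : V} {l r : PlaneForest V} (h : (node a l r).labels.Nodup) :
    treeLow a l ≠ r.low := by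
  obtain ⟨b, hb, hb'⟩ := exists_mem_treeLow_eq a l
  obtain ⟨h1, h2, -, -, h3⟩ := nodup_node.1 h
  intro h4
  rcases exists_mem_low_eq r with h5 | ⟨c, hc, h5⟩
  · rw [hb', h5] at h4
    exact WithTop.coe_ne_top h4
  · rw [hb', h5, WithTop.coe_inj] at h4
    subst h4
    rcases hb with rfl | hb
    · exact h2 hc
    · exact h3 hb hc

end Low

/-! ### Weights, and insertion of a largest label -/

section Weight

variable [LinearOrder V] {R : Type*} [CommSemiring R]

/-- The weight of an edge from `p` to the root of a tree with smallest label `b`, if `c` is the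
smallest label of the trees to its right. -/
def edgeWeight (t y x : R) (p b c : WithTop V) : R :=
  if c < b then t else if b < p then y else x

/-- The weight of a forest above the vertex `p`: each elder vertex contributes `t`, each improper
edge `y`, and each proper edge from a vertex `q` to a younger vertex `ω q`. -/
def weight (t y : R) (ω : V → R) : V → PlaneForest V → R
  | _, nil => 1
  | p, node a l r =>
    edgeWeight t y (ω p) p (treeLow a l) r.low * weight t y ω a l * weight t y ω p r

/-- The number of improper edges from `p` to the roots of a forest. -/
def rootImproper (p : V) : PlaneForest V → ℕ
  | nil => 0
  | node a l r =>
    (if treeLow a l < p ∧ ¬ r.low < treeLow a l then 1 else 0) + rootImproper p r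

/-- The number of improper edges inside a forest. -/
def innerImproper : PlaneForest V → ℕ
  | nil => 0
  | node a l r => rootImproper a l + innerImproper l + innerImproper r

/-- For every improper edge from `a` to a root `j` of the forest `l`, the two forests that consist
of the trees of `l` up to `j`, and of the tree with root `a` above the other trees of `l`, placed
immediately to the right or immediately to the left of the tree with root `j`. -/
def merges (a : V) : PlaneForest V → List (PlaneForest V)
  | nil => []
  | node j k r =>
    (if treeLow j k < a ∧ ¬ r.low < treeLow j k then
      [node j k (node a r nil), node a r (node j k nil)] else []) ++ (merges a r).map (node j k)

/-- The forests obtained from a given one by inserting a new largest label `m`. -/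
def ins (m : V) : PlaneForest V → List (PlaneForest V)
  | nil => [node m nil nil]
  | node a l r =>
    node m nil (node a l r) :: ((node a l nil :: merges a l).map (fun M => node m M r) ++
      ((ins m l).map (fun l' => node a l' r) ++ (ins m r).map (node a l)))

/-- A merge only rearranges `a` and `l`, so the minimum survives; the strict inequality is witnessed
by the improper edge that was chosen. It implies that moving `a` among its children does not affect
who is elder to the left of that edge. -/
theorem low_of_mem_merges {a : V} {l M : PlaneForest V} (h : M ∈ merges a l) :
    M.low = min (a : WithTop V) l.low ∧ l.low < a := by
  induction l generalizing M with
  | nil => simp [merges] at h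
  | node j k r _ ih =>
    simp only [merges, List.mem_append, List.mem_map] at h
    rcases h with h | ⟨M', hM', rfl⟩
    · split_ifs at h with hc
      · simp only [List.mem_cons, List.not_mem_nil, or_false] at h
        refine ⟨?_, (min_le_left _ _).trans_lt hc.1⟩
        rcases h with rfl | rfl
        · simp only [low, min_top_right]
          ac_rfl
        · simp only [low, min_top_right]
          ac_rfl
      · simp at h
    · obtain ⟨h1, h2⟩ := ih hM'
      refine ⟨?_, (min_le_right _ _).trans_lt h2⟩
      rw [low_node, h1, low_node]
      ac_rfl

theorem low_of_mem_ins {m : V} {f U : PlaneForest V} (h : U ∈ ins m f) :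
    U.low = min (m : WithTop V) f.low := by
  induction f generalizing U with
  | nil =>
    simp only [ins, List.mem_singleton] at h
    subst h
    simp [low]
  | node a l r ihl ihr =>
    simp only [ins, List.mem_cons, List.mem_append, List.mem_map] at h
    rcases h with rfl | ⟨M, rfl | hM, rfl⟩ | ⟨l', hl', rfl⟩ | ⟨r', hr', rfl⟩
    · simp only [low, min_top_right]
    · simp only [low, min_top_right]
      ac_rfl
    · simp only [low, (low_of_mem_merges hM).1]
      ac_rfl
    · simp only [low, ihl hl']
      ac_rfl
    · simp only [low, ihr hr']
      ac_rfl

theorem labels_of_mem_merges {a : V} {l M : PlaneForest V} (h : M ∈ merges a l) :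
    M.labels.Perm (a :: l.labels) := by
  classical
  induction l generalizing M with
  | nil => simp [merges] at h
  | node j k r _ ih =>
    simp only [merges, List.mem_append, List.mem_map] at h
    rcases h with h | ⟨M', hM', rfl⟩
    · split_ifs at h with hc
      · simp only [List.mem_cons, List.not_mem_nil, or_false] at h
        rw [List.perm_iff_count]
        intro b
        rcases h with rfl | rfl <;> simp [labels, List.count_cons, List.count_append] <;> omega
      · simp at h
    · have := ih hM'
      rw [List.perm_iff_count] at this ⊢
      intro b
      have := this b
      simp [labels, List.count_cons, List.count_append] at this ⊢
      omega

theorem labels_of_mem_ins {m : V} {f U : PlaneForest V} (h : U ∈ ins m f) :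
    U.labels.Perm (m :: f.labels) := by
  classical
  induction f generalizing U with
  | nil =>
    simp only [ins, List.mem_singleton] at h
    subst h
    simp [labels]
  | node a l r ihl ihr =>
    simp only [ins, List.mem_cons, List.mem_append, List.mem_map] at h
    rw [List.perm_iff_count]
    intro b
    rcases h with rfl | ⟨M, rfl | hM, rfl⟩ | ⟨l', hl', rfl⟩ | ⟨r', hr', rfl⟩
    · simp [labels]
    · simp [labels, List.count_cons, List.count_append]
    · have := List.perm_iff_count.1 (labels_of_mem_merges hM) b
      simp [labels, List.count_cons, List.count_append] at this ⊢
      omega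
    · have := List.perm_iff_count.1 (ihl hl') b
      simp [labels, List.count_cons, List.count_append] at this ⊢
      omega
    · have := List.perm_iff_count.1 (ihr hr') b
      simp [labels, List.count_cons, List.count_append] at this ⊢
      omega

/-- Each improper edge from `a` to a root `j` gives two forests above `m`. In both, `j` stays
younger with an improper edge; `a` contributes `y` to the right of `j` and `t` to the left. -/
theorem sum_weight_merges (t y : R) (ω : V → R) {m a : V} {l : PlaneForest V} (ham : a < m)
    (hl : ∀ b ∈ l.labels, b < m) (hn : l.labels.Nodup) :
    ((merges a l).map (weight t y ω m)).sum =
      (y + t) * (rootImproper a l : R) * weight t y ω a l := by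
  induction l with
  | nil => simp [merges, rootImproper]
  | node j k r _ ih =>
    have ih := ih (fun b hb => hl b (mem_labels_node.2 (Or.inr (Or.inr hb))))
      (nodup_node.1 hn).2.2.2.1
    have hjm : treeLow j k < m := (treeLow_le j k).trans_lt
      (WithTop.coe_lt_coe.2 (hl j (mem_labels_node.2 (Or.inl rfl))))
    have ham' : treeLow a r < m := (treeLow_le a r).trans_lt (WithTop.coe_lt_coe.2 ham)
    have hne := treeLow_ne_low hn
    -- A root to the left of the chosen edge keeps its weight when its parent `a` is replaced by
    -- `m`: if younger, its minimum is at most `r.low < a`, so its edge was already improper.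
    have hrest : ((merges a r).map (weight t y ω m ∘ node j k)).sum =
        edgeWeight t y (ω a) a (treeLow j k) r.low * weight t y ω j k *
          ((merges a r).map (weight t y ω m)).sum := by
      rw [← List.sum_map_mul_left]
      refine congrArg _ (List.map_congr_left fun M hM => ?_)
      obtain ⟨h1, h2⟩ := low_of_mem_merges hM
      simp only [Function.comp, weight, h1, min_eq_right h2.le]
      congr 2
      simp only [edgeWeight, if_pos hjm]
      split_ifs with h3 h4
      · rfl
      · rfl
      · exact absurd ((not_lt.1 h3).trans_lt h2) h4
    rw [merges, List.map_append, List.sum_append, List.map_map, hrest, ih]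
    by_cases hc : treeLow j k < a ∧ ¬ r.low < treeLow j k
    · have h5 : treeLow j k < treeLow a r :=
        lt_min hc.1 (lt_of_le_of_ne (not_lt.1 hc.2) hne)
      rw [rootImproper, if_pos hc, if_pos hc]
      simp only [List.map_cons, List.map_nil, List.sum_cons, List.sum_nil, weight, low_node_nil,
        low_nil, edgeWeight, hjm, ham', hc.1, hc.2, h5, not_lt_of_gt h5, not_top_lt, if_true,
        if_false]
      push_cast
      ring
    · rw [rootImproper, if_neg hc, if_neg hc, weight, List.map_nil, List.sum_nil, zero_add, zero_add]
      ring

theorem sum_weight_ins (t y : R) (ω : V → R) {m p : V} {f : PlaneForest V} (hp : p < m)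
    (hf : ∀ b ∈ f.labels, b < m) (hn : f.labels.Nodup) :
    ((ins m f).map (weight t y ω p)).sum = weight t y ω p f *
      (ω p + (f.labels.map ω).sum + (f.labels.length : R) * (t + y) +
        (y + t) * (innerImproper f : R)) := by
  induction f generalizing p with
  | nil =>
    -- The empty forest is the end of a list of children: `m` becomes a younger last child of `p`
    -- with a proper edge, of weight `ω p`.
    simp [ins, weight, edgeWeight, treeLow, low, labels, innerImproper, not_lt_of_gt hp]
  | node a l r ihl ihr =>
    have ham : a < m := hf a (mem_labels_node.2 (Or.inl rfl))
    have hlm : ∀ b ∈ l.labels, b < m := fun b hb => hf b (mem_labels_node.2 (Or.inr (Or.inl hb)))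
    have hrm : ∀ b ∈ r.labels, b < m := fun b hb => hf b (mem_labels_node.2 (Or.inr (Or.inr hb)))
    obtain ⟨-, -, hnl, hnr, -⟩ := nodup_node.1 hn
    have ihl := ihl ham hlm hnl
    have ihr := ihr hp hrm hnr
    have hlow : treeLow a l < m := (treeLow_le a l).trans_lt (WithTop.coe_lt_coe.2 ham)
    have e1 : weight t y ω p (node m nil (node a l r)) = t * weight t y ω p (node a l r) := by
      have h : (node a l r).low < treeLow m nil := by
        simp only [treeLow, low, min_top_right]
        exact (min_le_left _ _).trans_lt hlow
      rw [weight, edgeWeight, if_pos h, weight, mul_one]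
    -- When `m` takes the place of `a`, the subtree keeps its minimum, so the edge from `p` keeps
    -- its weight.
    have e2 : ∀ M : PlaneForest V, M.low = treeLow a l → weight t y ω p (node m M r) =
        edgeWeight t y (ω p) p (treeLow a l) r.low * weight t y ω p r * weight t y ω m M := by
      intro M hM
      rw [weight, treeLow, hM, min_eq_right hlow.le]
      ring
    have e3 : weight t y ω m (node a l nil) = y * weight t y ω a l := by
      simp [weight, edgeWeight, low, hlow]
    have e4 : ((merges a l).map (fun M => weight t y ω p (node m M r))).sum =
        edgeWeight t y (ω p) p (treeLow a l) r.low * weight t y ω p r *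
          ((merges a l).map (weight t y ω m)).sum := by
      rw [← List.sum_map_mul_left]
      exact congrArg _ (List.map_congr_left fun M hM => e2 M (low_of_mem_merges hM).1)
    have e5 : ((ins m l).map (fun l' => weight t y ω p (node a l' r))).sum =
        edgeWeight t y (ω p) p (treeLow a l) r.low * weight t y ω p r *
          ((ins m l).map (weight t y ω a)).sum := by
      rw [← List.sum_map_mul_left]
      refine congrArg _ (List.map_congr_left fun l' hl' => ?_)
      have : treeLow a l' = treeLow a l := by
        rw [treeLow, low_of_mem_ins hl', ← min_assoc, min_eq_left (WithTop.coe_le_coe.2 ham.le)]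
        rfl
      rw [weight, this]
      ring
    have e6 : ((ins m r).map (fun r' => weight t y ω p (node a l r'))).sum =
        edgeWeight t y (ω p) p (treeLow a l) r.low * weight t y ω a l *
          ((ins m r).map (weight t y ω p)).sum := by
      rw [← List.sum_map_mul_left]
      refine congrArg _ (List.map_congr_left fun r' hr' => ?_)
      rw [weight, low_of_mem_ins hr']
      congr 2
      -- Inserting `m` to the right of `a` cannot make `a` elder, as `m` exceeds the minimum of its
      -- tree.
      simp only [edgeWeight, min_lt_iff, not_lt_of_gt hlow, false_or]
    have e7 : weight t y ω p (node m (node a l nil) r) = y * weight t y ω p (node a l r) := by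
      rw [e2 _ (by simp [low, treeLow]), e3, weight]
      ring
    simp only [ins, List.map_cons, List.map_append, List.sum_cons, List.sum_append, List.map_map,
      Function.comp_def, e1, e7, e4, e5, e6, ihl, ihr, sum_weight_merges t y ω ham hlm hnl, labels,
      innerImproper, List.length_cons, List.length_append]
    rw [weight]
    push_cast
    ring

end Weight

end PlaneForest

/-! ### Deletion of the largest label, inverse to insertion -/

namespace PlaneForest

section Del

variable {V : Type*} [LinearOrder V]

/-- The inverse of `merges`: for a forest with a first tree of root `p` above `k`, followed by the
forest `s`, the vertex `a` and the forest `l` from which it was obtained. -/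
def unmerge : V → PlaneForest V → PlaneForest V → V × PlaneForest V
  | p, k, nil => (p, k)
  | p, k, node q l nil => if treeLow p k < treeLow q l then (q, node p k l) else (p, node q l k)
  | p, k, node q l (node s l' r) =>
    ((unmerge q l (node s l' r)).1, node p k (unmerge q l (node s l' r)).2)

/-- The inverse of `ins`: removal of the largest label `m`. -/
def del (m : V) : PlaneForest V → PlaneForest V
  | nil => nil
  | node a nil r => if a = m then r else node a nil (del m r)
  | node a (node p k s) r =>
    if a = m then node (unmerge p k s).1 (unmerge p k s).2 r
    else node a (del m (node p k s)) (del m r)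

theorem del_node_self_nil (m : V) (r : PlaneForest V) : del m (node m nil r) = r := by
  rw [del, if_pos rfl]

theorem del_node_self (m p : V) (k s r : PlaneForest V) : del m (node m (node p k s) r) =
    node (unmerge p k s).1 (unmerge p k s).2 r := by
  rw [del, if_pos rfl]

theorem del_node_of_ne {m a : V} (h : a ≠ m) (l r : PlaneForest V) :
    del m (node a l r) = node a (del m l) (del m r) := by
  cases l with
  | nil =>
    change _ = node a nil _
    rw [del, if_neg h]
  | node p k s => rw [del, if_neg h]

theorem del_eq_self {m : V} {f : PlaneForest V} (h : m ∉ f.labels) : del m f = f := by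
  induction f with
  | nil => rfl
  | node a l r ihl ihr =>
    simp only [mem_labels_node, not_or] at h
    rw [del_node_of_ne (Ne.symm h.1), ihl h.2.1, ihr h.2.2]

/-- Having at least two trees separates the merges from the insertions where `m` is a leaf or has
the only child `a`. -/
theorem exists_of_mem_merges {a : V} {l M : PlaneForest V} (h : M ∈ merges a l) :
    ∃ p k q k' r, M = node p k (node q k' r) := by
  cases l with
  | nil => simp [merges] at h
  | node j k r =>
    simp only [merges, List.mem_append, List.mem_map] at h
    rcases h with h | ⟨M', hM', rfl⟩
    · split_ifs at h with hc
      · simp only [List.mem_cons, List.not_mem_nil, or_false] at h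
        rcases h with rfl | rfl
        · exact ⟨_, _, _, _, _, rfl⟩
        · exact ⟨_, _, _, _, _, rfl⟩
      · simp at h
    · cases M' with
      | nil => exact absurd (low_of_mem_merges hM').1 (by
          have := min_le_left (a : WithTop V) r.low
          intro h
          rw [← h] at this
          exact absurd (WithTop.coe_lt_top a) (not_lt.2 this))
      | node q k' r' => exact ⟨_, _, _, _, _, rfl⟩

/-- The last two trees are those of `j` and `a`. As `j` was younger with an improper edge, its tree
has the smaller minimum, which tells the two apart. -/
theorem unmerge_of_mem_merges {a p : V} {l k s : PlaneForest V} (hn : l.labels.Nodup)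
    (h : node p k s ∈ merges a l) : unmerge p k s = (a, l) := by
  induction l generalizing p k s with
  | nil => simp [merges] at h
  | node j k' r _ ih =>
    simp only [merges, List.mem_append, List.mem_map] at h
    rcases h with h | ⟨M', hM', h⟩
    · split_ifs at h with hc
      · have hlt : treeLow j k' < treeLow a r :=
          lt_min hc.1 (lt_of_le_of_ne (not_lt.1 hc.2) (treeLow_ne_low hn))
        simp only [List.mem_cons, List.not_mem_nil, or_false, node.injEq] at h
        rcases h with ⟨rfl, rfl, rfl⟩ | ⟨rfl, rfl, rfl⟩
        · rw [unmerge, if_pos hlt]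
        · rw [unmerge, if_neg (not_lt_of_gt hlt)]
      · simp at h
    · obtain ⟨p', k₁, q, k₂, r', rfl⟩ := exists_of_mem_merges hM'
      rw [node.injEq] at h
      obtain ⟨rfl, rfl, rfl⟩ := h
      rw [unmerge, ih (nodup_node.1 hn).2.2.2.1 hM']

/-- Of the last two roots, the one with the smaller minimum, put back as a child in front of the
other's children, is younger and has an improper edge. The head of the list covers a single tree. -/
theorem mem_merges_unmerge {p : V} {k s : PlaneForest V} (hn : (node p k s).labels.Nodup) :
    node p k s ∈ node (unmerge p k s).1 (unmerge p k s).2 nil ::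
      merges (unmerge p k s).1 (unmerge p k s).2 := by
  induction s generalizing p k with
  | nil => simp [unmerge]
  | node q l s ihl ihs =>
    obtain ⟨h1, h2, h3, h4, h5⟩ := nodup_node.1 hn
    cases s with
    | nil =>
      have hq := treeLow_le q l
      have hne : treeLow p k ≠ treeLow q l := by
        have := treeLow_ne_low hn
        rwa [low_node, low, min_top_right] at this
      rw [unmerge]
      split_ifs with hlt
      · have hc : treeLow p k < q ∧ ¬ l.low < treeLow p k :=
          ⟨hlt.trans_le hq, not_lt.2 (hlt.le.trans (min_le_right _ _))⟩
        exact List.mem_cons_of_mem _ (by simp only [merges, if_pos hc]; simp)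
      · have hlt' := lt_of_le_of_ne (not_lt.1 hlt) hne.symm
        have hc : treeLow q l < p ∧ ¬ k.low < treeLow q l :=
          ⟨hlt'.trans_le (treeLow_le _ _), not_lt.2 (hlt'.le.trans (min_le_right _ _))⟩
        exact List.mem_cons_of_mem _ (by simp only [merges, if_pos hc]; simp)
    | node s l' r =>
      have := ihs h4
      rw [unmerge]
      rcases List.mem_cons.1 this with h | h
      · simp at h
      · refine List.mem_cons_of_mem _ ?_
        simp only [merges, List.mem_append, List.mem_map]
        exact Or.inr ⟨_, h, rfl⟩

theorem del_of_mem_ins {m : V} {f U : PlaneForest V} (hm : m ∉ f.labels) (hn : f.labels.Nodup)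
    (h : U ∈ ins m f) : del m U = f := by
  induction f generalizing U with
  | nil =>
    simp only [ins, List.mem_singleton] at h
    rw [h, del_node_self_nil]
  | node a l r ihl ihr =>
    simp only [mem_labels_node, not_or] at hm
    obtain ⟨h1, h2, h3, h4, h5⟩ := nodup_node.1 hn
    simp only [ins, List.mem_cons, List.mem_append, List.mem_map] at h
    rcases h with rfl | ⟨M, rfl | hM, rfl⟩ | ⟨l', hl', rfl⟩ | ⟨r', hr', rfl⟩
    · rw [del_node_self_nil]
    · rw [del_node_self, unmerge]
    · obtain ⟨p, k, q, k', s, rfl⟩ := exists_of_mem_merges hM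
      rw [del_node_self, unmerge_of_mem_merges h3 hM]
    · rw [del_node_of_ne (Ne.symm hm.1), ihl hm.2.1 h3 hl', del_eq_self hm.2.2]
    · rw [del_node_of_ne (Ne.symm hm.1), ihr hm.2.2 h4 hr', del_eq_self hm.2.1]

theorem mem_ins_del {m : V} {U : PlaneForest V} (hm : m ∈ U.labels) (hn : U.labels.Nodup) :
    U ∈ ins m (del m U) := by
  induction U with
  | nil => simp [labels] at hm
  | node a l r ihl ihr =>
    obtain ⟨h1, h2, h3, h4, h5⟩ := nodup_node.1 hn
    by_cases ha : a = m
    · subst ha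
      cases l with
      | nil =>
        rw [del_node_self_nil]
        cases r <;> simp [ins]
      | node p k s =>
        rw [del_node_self, ins]
        simp only [List.mem_cons, List.mem_append, List.mem_map]
        exact Or.inr (Or.inl ⟨_, List.mem_cons.1 (mem_merges_unmerge h3), rfl⟩)
    · rw [del_node_of_ne ha, ins]
      simp only [List.mem_cons, List.mem_append, List.mem_map]
      rcases mem_labels_node.1 hm with h | h | h
      · exact absurd h.symm ha
      · rw [del_eq_self (h5 h)]
        exact Or.inr (Or.inr (Or.inl ⟨_, ihl h h3, rfl⟩))
      · rw [del_eq_self (fun h' => h5 h' h)]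
        exact Or.inr (Or.inr (Or.inr ⟨_, ihr h h4, rfl⟩))

theorem nodup_merges {a : V} {l : PlaneForest V} (ha : a ∉ l.labels) : (merges a l).Nodup := by
  induction l with
  | nil => simp [merges]
  | node j k r _ ih =>
    simp only [mem_labels_node, not_or] at ha
    rw [merges, List.nodup_append']
    refine ⟨?_, (ih ha.2.2).map fun x y h => (node.inj h).2.2, ?_⟩
    · split_ifs
      · simp [Ne.symm ha.1]
      · simp
    · intro M hM hM'
      obtain ⟨M', hM₁, rfl⟩ := List.mem_map.1 hM'
      obtain ⟨p, k', q, k'', r', rfl⟩ := exists_of_mem_merges hM₁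
      split_ifs at hM
      · simp at hM
      · simp at hM

theorem nodup_ins {m : V} {f : PlaneForest V} (hm : m ∉ f.labels) (hn : f.labels.Nodup) :
    (ins m f).Nodup := by
  induction f with
  | nil => simp [ins]
  | node a l r ihl ihr =>
    simp only [mem_labels_node, not_or] at hm
    obtain ⟨h1, h2, h3, h4, h5⟩ := nodup_node.1 hn
    rw [ins, List.nodup_cons, List.nodup_append', List.nodup_append']
    refine ⟨?_, ?_, ⟨?_, ?_, ?_⟩, ?_⟩
    · simp only [List.mem_append, List.mem_map, List.mem_cons, not_or]
      refine ⟨?_, ?_, ?_⟩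
      · rintro ⟨M, rfl | hM, h⟩
        · simp at h
        · obtain ⟨p, k, q, k', s, rfl⟩ := exists_of_mem_merges hM
          simp at h
      · rintro ⟨l', -, h⟩
        exact hm.1 (node.inj h).1.symm
      · rintro ⟨l', -, h⟩
        exact hm.1 (node.inj h).1.symm
    · refine List.Nodup.map (fun x y h => (node.inj h).2.1) (List.nodup_cons.2 ⟨?_, nodup_merges h1⟩)
      intro h
      obtain ⟨p, k, q, k', s, h⟩ := exists_of_mem_merges h
      simp at h
    · exact (ihl hm.2.1 h3).map fun x y h => (node.inj h).2.1
    · exact (ihr hm.2.2 h4).map fun x y h => (node.inj h).2.2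
    · intro U hU hU'
      obtain ⟨l', hl', rfl⟩ := List.mem_map.1 hU
      obtain ⟨r', -, h⟩ := List.mem_map.1 hU'
      rw [← (node.inj h).2.1] at hl'
      exact hm.2.1 ((labels_of_mem_ins hl').mem_iff.2 (List.mem_cons_self))
    · intro U hU hU'
      obtain ⟨M, -, rfl⟩ := List.mem_map.1 hU
      rcases List.mem_append.1 hU' with h | h
      · obtain ⟨l', -, h⟩ := List.mem_map.1 h
        exact hm.1 (node.inj h).1.symm
      · obtain ⟨l', -, h⟩ := List.mem_map.1 h
        exact hm.1 (node.inj h).1.symm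

end Del

/-! ### Forests on the labels 1, …, n -/

open Classical in
/-- The forests whose labels are `1, …, n`, each used once. -/
noncomputable def forests : ℕ → Finset (PlaneForest ℕ)
  | 0 => {nil}
  | n + 1 => (forests n).biUnion fun f => (ins (n + 1) f).toFinset

theorem mem_forests {n : ℕ} {f : PlaneForest ℕ} :
    f ∈ forests n ↔ f.labels.Nodup ∧ ∀ a, a ∈ f.labels ↔ 1 ≤ a ∧ a ≤ n := by
  induction n generalizing f with
  | zero =>
    simp only [forests, Finset.mem_singleton]
    constructor
    · rintro rfl
      simp [labels]
      omega
    · rintro ⟨-, h⟩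
      cases f with
      | nil => rfl
      | node a l r =>
        have := (h a).1 (mem_labels_node.2 (Or.inl rfl))
        omega
  | succ n ih =>
    simp only [forests, Finset.mem_biUnion, List.mem_toFinset]
    constructor
    · rintro ⟨g, hg, hf⟩
      obtain ⟨h1, h2⟩ := ih.1 hg
      have hp := labels_of_mem_ins hf
      refine ⟨hp.nodup_iff.2 (List.nodup_cons.2 ⟨fun h => ?_, h1⟩), fun a => ?_⟩
      · have := (h2 _).1 h
        omega
      · rw [hp.mem_iff, List.mem_cons, h2]
        omega
    · rintro ⟨h1, h2⟩
      have hm := mem_ins_del ((h2 (n + 1)).2 (by omega)) h1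
      have hp := labels_of_mem_ins hm
      have h3 := List.nodup_cons.1 (hp.nodup_iff.1 h1)
      refine ⟨_, ih.2 ⟨h3.2, fun a => ?_⟩, hm⟩
      have h4 := h2 a
      rw [hp.mem_iff, List.mem_cons] at h4
      have h5 : a ∈ (del (n + 1) f).labels → a ≠ n + 1 := fun h h' => h3.1 (h' ▸ h)
      constructor
      · intro h
        have := h4.1 (Or.inr h)
        have := h5 h
        omega
      · intro h
        exact (h4.2 (by omega)).resolve_left (by omega)

theorem sum_forests_succ {M : Type*} [AddCommMonoid M] (n : ℕ) (F : PlaneForest ℕ → M) :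
    ∑ f ∈ forests (n + 1), F f = ∑ f ∈ forests n, ((ins (n + 1) f).map F).sum := by
  classical
  have hlab : ∀ f ∈ forests n, n + 1 ∉ f.labels ∧ f.labels.Nodup := by
    intro f hf
    obtain ⟨h1, h2⟩ := mem_forests.1 hf
    refine ⟨fun h => ?_, h1⟩
    have := (h2 _).1 h
    omega
  rw [forests, Finset.sum_biUnion]
  · refine Finset.sum_congr rfl fun f hf => ?_
    rw [List.sum_toFinset _ (nodup_ins (hlab f hf).1 (hlab f hf).2)]
  · intro f hf g hg hfg
    refine Finset.disjoint_left.2 fun U hU hU' => hfg ?_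
    rw [List.mem_toFinset] at hU hU'
    rw [← del_of_mem_ins (hlab f hf).1 (hlab f hf).2 hU,
      del_of_mem_ins (hlab g hg).1 (hlab g hg).2 hU']

end PlaneForest

/-! ### Forests as children functions, and relabelling -/

namespace PlaneForest

variable {V W : Type*}

/-- The forest `f` consists of the trees above its roots in the digraph where the children of `a`
are listed by `g a`. -/
def Represents (g : V → List V) : PlaneForest V → Prop
  | nil => True
  | node a l r => g a = l.roots ∧ Represents g l ∧ Represents g r

theorem Represents.unique {g : V → List V} {f f' : PlaneForest V} (h : Represents g f)
    (h' : Represents g f') (hr : f.roots = f'.roots) : f = f' := by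
  induction f generalizing f' with
  | nil =>
    cases f' with
    | nil => rfl
    | node a l r => simp [roots] at hr
  | node a l r ihl ihr =>
    cases f' with
    | nil => simp [roots] at hr
    | node a' l' r' =>
      simp only [roots, List.cons.injEq] at hr
      obtain ⟨rfl, hr⟩ := hr
      rw [ihl h.2.1 h'.2.1 (h.1.symm.trans h'.1), ihr h.2.2 h'.2.2 hr]

theorem Represents.congr {g g' : V → List V} {f : PlaneForest V} (h : Represents g f)
    (hg : ∀ a ∈ f.labels, g' a = g a) : Represents g' f := by
  induction f with
  | nil => trivial
  | node a l r ihl ihr =>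
    simp only [mem_labels_node] at hg
    exact ⟨(hg a (Or.inl rfl)).trans h.1, ihl h.2.1 fun b hb => hg b (Or.inr (Or.inl hb)),
      ihr h.2.2 fun b hb => hg b (Or.inr (Or.inr hb))⟩

theorem Represents.mem_labels_iff {g : V → List V} {f : PlaneForest V} (h : Represents g f) {x : V} :
    x ∈ f.labels ↔ ∃ b ∈ f.roots, Relation.ReflTransGen (fun a b => b ∈ g a) b x := by
  induction f with
  | nil => simp [labels, roots]
  | node a l r ihl ihr =>
    rw [mem_labels_node, ihl h.2.1, ihr h.2.2]
    simp only [roots, List.mem_cons, exists_eq_or_imp]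
    rw [← or_assoc]
    refine or_congr_left ?_
    rw [Relation.ReflTransGen.cases_head_iff, h.1, eq_comm]

theorem mem_labels_of_mem_roots {f : PlaneForest V} {a : V} (h : a ∈ f.roots) : a ∈ f.labels := by
  induction f with
  | nil => simp [roots] at h
  | node b l r _ ih =>
    rw [mem_labels_node]
    rcases List.mem_cons.1 h with h | h
    · exact Or.inl h
    · exact Or.inr (Or.inr (ih h))

theorem roots_nodup {f : PlaneForest V} (h : f.labels.Nodup) : f.roots.Nodup := by
  induction f with
  | nil => simp [roots]
  | node a l r _ ih =>
    obtain ⟨-, h2, -, h4, -⟩ := nodup_node.1 h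
    exact List.nodup_cons.2 ⟨fun h => h2 (mem_labels_of_mem_roots h), ih h4⟩

section Lookup

variable [DecidableEq V]

/-- The children of the vertex `v` in a forest. -/
def lookup : PlaneForest V → V → List V
  | nil, _ => []
  | node a l r, v => if v = a then l.roots else lookup l v ++ lookup r v

theorem lookup_eq_nil {f : PlaneForest V} {v : V} (h : v ∉ f.labels) : f.lookup v = [] := by
  induction f with
  | nil => rfl
  | node a l r ihl ihr =>
    simp only [mem_labels_node, not_or] at h
    rw [lookup, if_neg h.1, ihl h.2.1, ihr h.2.2, List.append_nil]

theorem represents_lookup {f : PlaneForest V} (h : f.labels.Nodup) : Represents f.lookup f := by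
  induction f with
  | nil => trivial
  | node a l r ihl ihr =>
    obtain ⟨h1, h2, h3, h4, h5⟩ := nodup_node.1 h
    refine ⟨by rw [lookup, if_pos rfl], (ihl h3).congr fun b hb => ?_, (ihr h4).congr fun b hb => ?_⟩
    · rw [lookup, if_neg (by rintro rfl; exact h1 hb), lookup_eq_nil (h5 hb), List.append_nil]
    · rw [lookup, if_neg (by rintro rfl; exact h2 hb), lookup_eq_nil fun h => h5 h hb,
        List.nil_append]

theorem of_mem_lookup {f : PlaneForest V} (h : f.labels.Nodup) {v w : V} (hw : w ∈ f.lookup v) :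
    v ∈ f.labels ∧ w ∈ f.labels ∧ w ∉ f.roots := by
  induction f with
  | nil => simp [lookup] at hw
  | node a l r ihl ihr =>
    obtain ⟨h1, h2, h3, h4, h5⟩ := nodup_node.1 h
    have hl : w ∈ l.labels → w ∈ (node a l r).labels ∧ w ∉ (node a l r).roots := by
      intro hwl
      refine ⟨mem_labels_node.2 (Or.inr (Or.inl hwl)), fun h' => ?_⟩
      rcases List.mem_cons.1 h' with rfl | h'
      · exact h1 hwl
      · exact h5 hwl (mem_labels_of_mem_roots h')
    rw [lookup] at hw
    split_ifs at hw with hv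
    · exact ⟨mem_labels_node.2 (Or.inl hv), hl (mem_labels_of_mem_roots hw)⟩
    · rcases List.mem_append.1 hw with hw | hw
      · obtain ⟨h6, h7, -⟩ := ihl h3 hw
        exact ⟨mem_labels_node.2 (Or.inr (Or.inl h6)), hl h7⟩
      · obtain ⟨h6, h7, h8⟩ := ihr h4 hw
        refine ⟨mem_labels_node.2 (Or.inr (Or.inr h6)), mem_labels_node.2 (Or.inr (Or.inr h7)), ?_⟩
        intro h'
        rcases List.mem_cons.1 h' with rfl | h'
        · exact h2 h7
        · exact h8 h'

theorem lookup_nodup {f : PlaneForest V} (h : f.labels.Nodup) (v : V) : (f.lookup v).Nodup := by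
  induction f with
  | nil => simp [lookup]
  | node a l r ihl ihr =>
    obtain ⟨h1, h2, h3, h4, h5⟩ := nodup_node.1 h
    rw [lookup]
    split_ifs
    · exact roots_nodup h3
    · exact List.nodup_append'.2 ⟨ihl h3, ihr h4, fun x hx hx' =>
        h5 (of_mem_lookup h3 hx).2.1 (of_mem_lookup h4 hx').2.1⟩

theorem lookup_parent_unique {f : PlaneForest V} (h : f.labels.Nodup) {u v w : V}
    (hu : w ∈ f.lookup u) (hv : w ∈ f.lookup v) : u = v := by
  induction f with
  | nil => simp [lookup] at hu
  | node a l r ihl ihr =>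
    obtain ⟨-, -, h3, h4, h5⟩ := nodup_node.1 h
    have key : ∀ z, w ∈ (node a l r).lookup z →
        (z = a ∧ w ∈ l.roots) ∨ w ∈ l.lookup z ∨ w ∈ r.lookup z := by
      intro z hz
      rw [lookup] at hz
      split_ifs at hz with h
      · exact Or.inl ⟨h, hz⟩
      · exact Or.inr (List.mem_append.1 hz)
    replace hu := key u hu
    replace hv := key v hv
    clear key
    rcases hu with ⟨rfl, hu⟩ | hu | hu <;> rcases hv with ⟨rfl, hv⟩ | hv | hv
    · rfl
    · exact absurd hu (of_mem_lookup h3 hv).2.2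
    · exact absurd (of_mem_lookup h4 hv).2.1 (h5 (mem_labels_of_mem_roots hu))
    · exact absurd hv (of_mem_lookup h3 hu).2.2
    · exact ihl h3 hu hv
    · exact absurd (of_mem_lookup h4 hv).2.1 (h5 (of_mem_lookup h3 hu).2.1)
    · exact absurd (of_mem_lookup h4 hu).2.1 (h5 (mem_labels_of_mem_roots hv))
    · exact absurd (of_mem_lookup h4 hu).2.1 (h5 (of_mem_lookup h3 hv).2.1)
    · exact ihr h4 hu hv

/-- The plane tree with root `p` above the forest `f`. -/
def toPlaneTree (p : V) (f : PlaneForest V) (hf : f.labels.Nodup) (hp : ∀ x, x ∈ f.labels ↔ x ≠ p) :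
    PlaneTree V where
  root := p
  children v := if v = p then f.roots else f.lookup v
  nodup v := by
    split_ifs
    · exact roots_nodup hf
    · exact lookup_nodup hf v
  root_notMem v h := by
    refine (hp p).1 ?_ rfl
    split_ifs at h
    · exact mem_labels_of_mem_roots h
    · exact (of_mem_lookup hf h).2.1
  parent_unique u v w hu hv := by
    split_ifs at hu hv with h1 h2 h2
    · rw [h1, h2]
    · exact absurd hu (of_mem_lookup hf hv).2.2
    · exact absurd hv (of_mem_lookup hf hu).2.2
    · exact lookup_parent_unique hf hu hv
  reachable v := by
    by_cases hv : v = p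
    · rw [hv]
    · have hrep : Represents (fun v => if v = p then f.roots else f.lookup v) f :=
        (represents_lookup hf).congr fun a ha => if_neg ((hp a).1 ha)
      obtain ⟨b, hb, h⟩ := hrep.mem_labels_iff.1 ((hp v).2 hv)
      exact Relation.ReflTransGen.head (by rwa [if_pos rfl]) h

end Lookup

/-- The forest with every label `v` replaced by `φ v`. -/
def map (φ : V → W) : PlaneForest V → PlaneForest W
  | nil => nil
  | node a l r => node (φ a) (map φ l) (map φ r)

theorem labels_map (φ : V → W) (f : PlaneForest V) : (f.map φ).labels = f.labels.map φ := by
  induction f with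
  | nil => rfl
  | node a l r ihl ihr => simp [map, labels, ihl, ihr]

theorem map_map {X : Type*} (φ : V → W) (ψ : W → X) (f : PlaneForest V) :
    (f.map φ).map ψ = f.map (ψ ∘ φ) := by
  induction f with
  | nil => rfl
  | node a l r ihl ihr => simp [map, ihl, ihr]

theorem map_eq_self {φ : V → V} {f : PlaneForest V} (h : ∀ a ∈ f.labels, φ a = a) :
    f.map φ = f := by
  induction f with
  | nil => rfl
  | node a l r ihl ihr =>
    simp only [mem_labels_node] at h
    rw [map, h a (Or.inl rfl), ihl fun b hb => h b (Or.inr (Or.inl hb)),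
      ihr fun b hb => h b (Or.inr (Or.inr hb))]

theorem map_injective {φ : V → W} (hφ : Function.Injective φ) : Function.Injective (map φ) := by
  intro f
  induction f with
  | nil =>
    rintro (_ | _) h
    · rfl
    · simp [map] at h
  | node a l r ihl ihr =>
    rintro (_ | ⟨a', l', r'⟩) h
    · simp [map] at h
    · simp only [map, node.injEq] at h
      rw [hφ h.1, ihl h.2.1, ihr h.2.2]

section Monotone

variable [LinearOrder V] [LinearOrder W] {φ : V → W}

theorem low_map (hφ : StrictMono φ) (f : PlaneForest V) : (f.map φ).low = f.low.map φ := by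
  induction f with
  | nil => rfl
  | node a l r ihl ihr =>
    have hm : Monotone (WithTop.map φ) := hφ.monotone.withTop_map
    rw [map, low, low, ihl, ihr, hm.map_min, hm.map_min, WithTop.map_coe]

theorem treeLow_map (hφ : StrictMono φ) (a : V) (f : PlaneForest V) :
    treeLow (φ a) (f.map φ) = (treeLow a f).map φ := by
  have hm : Monotone (WithTop.map φ) := hφ.monotone.withTop_map
  rw [treeLow, treeLow, low_map hφ, hm.map_min, WithTop.map_coe]

/-- Apart from `ω`, weights depend only on comparisons of labels. -/
theorem weight_map {R : Type*} [CommSemiring R] (t y : R) (ω : W → R) (hφ : StrictMono φ) (p : V)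
    (f : PlaneForest V) : weight t y ω (φ p) (f.map φ) = weight t y (ω ∘ φ) p f := by
  induction f generalizing p with
  | nil => rfl
  | node a l r ihl ihr =>
    have hs : StrictMono (WithTop.map φ) := hφ.withTop_map
    rw [map, weight, weight, ihl, ihr, treeLow_map hφ, low_map hφ, edgeWeight, edgeWeight,
      ← WithTop.map_coe]
    simp only [hs.lt_iff_lt, Function.comp]

end Monotone

end PlaneForest

/-! ### The forest above the root of a plane tree -/

namespace PlaneTree

open PlaneForest

variable {V : Type*} (T : PlaneTree V)

/-- A cycle through a vertex passes through its unique parent, hence by induction through the root,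
which has no parent. -/
theorem acyclic (v : V) : ¬ Relation.TransGen (fun a b => b ∈ T.children a) v v := by
  have h := T.reachable v
  induction h with
  | refl =>
    intro h
    obtain ⟨u, -, hu⟩ := Relation.TransGen.tail'_iff.1 h
    exact T.root_notMem u hu
  | tail _ hvw ih =>
    intro h
    obtain ⟨u, hu, hu'⟩ := Relation.TransGen.tail'_iff.1 h
    rw [T.parent_unique _ _ _ hu' hvw] at hu
    exact ih (Relation.TransGen.head' hvw hu)

variable {T}

theorem not_isDescendant_of_mem_children {v a : V} (h : a ∈ T.children v) : ¬ T.IsDescendant a v :=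
  fun h' => T.acyclic v (Relation.TransGen.head' h h')

theorem eq_of_isDescendant_of_mem_children {v a b : V} (ha : a ∈ T.children v)
    (hb : b ∈ T.children v) (h : T.IsDescendant a b) : a = b := by
  rcases Relation.ReflTransGen.cases_tail_iff _ _ _ |>.1 h with h | ⟨u, hu, hu'⟩
  · exact h.symm
  · rw [T.parent_unique _ _ _ hu' hb] at hu
    exact absurd hu (not_isDescendant_of_mem_children ha)

theorem isDescendant_total {a b x : V} (ha : T.IsDescendant a x) (hb : T.IsDescendant b x) :
    T.IsDescendant a b ∨ T.IsDescendant b a := by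
  have := Relation.ReflTransGen.total_of_right_unique
    (r := Function.swap fun a b => b ∈ T.children a)
    (fun w u v hu hv => T.parent_unique u v w hu hv)
    (Relation.reflTransGen_swap.2 ha) (Relation.reflTransGen_swap.2 hb)
  exact this.symm.imp Relation.reflTransGen_swap.1 Relation.reflTransGen_swap.1

/-- Subtrees of distinct brothers are disjoint because the ancestors of a vertex form a chain. The
prefix `s` lets the induction run over final segments of a list of children. -/
theorem nodup_labels {f : PlaneForest V} {v : V} {s : List V} (hs : T.children v = s ++ f.roots)
    (hf : Represents T.children f) : f.labels.Nodup := by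
  induction f generalizing v s with
  | nil => simp [labels]
  | node a l r ihl ihr =>
    obtain ⟨h1, h2, h3⟩ := hf
    have ha : a ∈ T.children v := by simp [hs, roots]
    have hne : ∀ b ∈ r.roots, b ∈ T.children v ∧ b ≠ a := by
      intro b hb
      refine ⟨by simp [hs, roots, hb], ?_⟩
      rintro rfl
      have := T.nodup v
      rw [hs, roots] at this
      exact (List.nodup_cons.1 (List.nodup_append'.1 this).2.1).1 hb
    rw [nodup_node]
    refine ⟨?_, ?_, ihl (v := a) (s := []) h1 h2,
      ihr (v := v) (s := s ++ [a]) (by simpa [roots] using hs) h3, ?_⟩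
    · rw [h2.mem_labels_iff, ← h1]
      rintro ⟨b, hb, h⟩
      exact not_isDescendant_of_mem_children hb h
    · rw [h3.mem_labels_iff]
      rintro ⟨b, hb, h⟩
      exact (hne b hb).2 (eq_of_isDescendant_of_mem_children (hne b hb).1 ha h)
    · intro x hx hx'
      rw [h2.mem_labels_iff, ← h1] at hx
      rw [h3.mem_labels_iff] at hx'
      obtain ⟨c, hc, hcx⟩ := hx
      obtain ⟨b, hb, hbx⟩ := hx'
      rcases isDescendant_total (T := T) (Relation.ReflTransGen.head hc hcx) hbx with h | h
      · exact (hne b hb).2 (eq_of_isDescendant_of_mem_children ha (hne b hb).1 h).symm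
      · exact (hne b hb).2 (eq_of_isDescendant_of_mem_children (hne b hb).1 ha h)

variable (T) in
theorem exists_represents [Finite V] (v : V) :
    ∃ f : PlaneForest V, Represents T.children f ∧ f.roots = T.children v := by
  have : IsTrans V (Function.swap (Relation.TransGen fun a b => b ∈ T.children a)) :=
    ⟨fun _ _ _ h h' => h'.trans h⟩
  have : Std.Irrefl (Function.swap (Relation.TransGen fun a b => b ∈ T.children a)) :=
    ⟨fun a => T.acyclic a⟩
  induction v using (Finite.wellFounded_of_trans_of_irrefl
    (Function.swap (Relation.TransGen fun a b => b ∈ T.children a))).induction with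
  | _ v ih =>
    have key : ∀ s : List V, (∀ a ∈ s, a ∈ T.children v) →
        ∃ f : PlaneForest V, Represents T.children f ∧ f.roots = s := by
      intro s
      induction s with
      | nil => exact fun _ => ⟨nil, trivial, rfl⟩
      | cons a s ihs =>
        intro hs
        obtain ⟨r, hr, hr'⟩ := ihs fun b hb => hs b (List.mem_cons_of_mem _ hb)
        obtain ⟨l, hl, hl'⟩ := ih a (Relation.TransGen.single (hs a List.mem_cons_self))
        exact ⟨node a l r, ⟨hl'.symm, hl, hr⟩, by rw [roots, hr']⟩
    exact key _ fun _ h => h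

theorem mem_labels_iff_ne_root {f : PlaneForest V} (hf : Represents T.children f)
    (hr : f.roots = T.children T.root) (x : V) : x ∈ f.labels ↔ x ≠ T.root := by
  rw [hf.mem_labels_iff, hr]
  constructor
  · rintro ⟨b, hb, h⟩ rfl
    exact not_isDescendant_of_mem_children hb h
  · intro hx
    rcases Relation.ReflTransGen.cases_head_iff.1 (T.reachable x) with h | h
    · exact absurd h.symm hx
    · exact h

end PlaneTree

theorem List.mem_of_pair_sublist_append_cons {α : Type*} {a b : α} {s s' : List α}
    (hn : (s ++ a :: s').Nodup) (h : List.Sublist [a, b] (s ++ a :: s')) : b ∈ s' := by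
  obtain ⟨l₁, l₂, h1, h2, h3⟩ := List.sublist_append_iff.1 h
  cases l₁ with
  | nil =>
    rw [List.nil_append] at h1
    rw [← h1, List.cons_sublist_cons] at h3
    exact List.singleton_sublist.1 h3
  | cons c l₁ =>
    simp only [List.cons_append, List.cons.injEq] at h1
    obtain ⟨rfl, -⟩ := h1
    exact absurd List.mem_cons_self
      ((List.nodup_append'.1 hn).2.2 (h2.subset List.mem_cons_self))

/-! ### Tree statistics read off from the forest -/

namespace PlaneTree

open PlaneForest

section Forest

variable {V : Type*} {T : PlaneTree V}

theorem mem_labels_iff_isDescendant {a : V} {l : PlaneForest V} (ha : T.children a = l.roots)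
    (hl : Represents T.children l) {x : V} :
    x ∈ (node a l nil).labels ↔ T.IsDescendant a x := by
  have : Represents T.children (node a l nil) := ⟨ha, hl, trivial⟩
  rw [this.mem_labels_iff]
  simp [roots, IsDescendant]

/-- The forest above the root of a plane tree. -/
noncomputable def forest [Finite V] (T : PlaneTree V) : PlaneForest V :=
  (T.exists_represents T.root).choose

variable (T) [Finite V]

theorem represents_forest : Represents T.children T.forest :=
  (T.exists_represents T.root).choose_spec.1

theorem roots_forest : T.forest.roots = T.children T.root :=
  (T.exists_represents T.root).choose_spec.2

theorem nodup_labels_forest : T.forest.labels.Nodup :=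
  nodup_labels (T := T) (v := T.root) (s := []) T.roots_forest.symm T.represents_forest

variable {T}

theorem mem_labels_forest {x : V} : x ∈ T.forest.labels ↔ x ≠ T.root :=
  mem_labels_iff_ne_root T.represents_forest T.roots_forest x

theorem forest_injective {S T : PlaneTree V} (hr : S.root = T.root) (h : S.forest = T.forest) :
    S = T := by
  have key : ∀ {f : PlaneForest V}, Represents S.children f → Represents T.children f →
      ∀ v ∈ f.labels, S.children v = T.children v := by
    intro f hS hT
    induction f with
    | nil => simp [labels]
    | node a l r ihl ihr =>
      intro v hv
      rcases mem_labels_node.1 hv with rfl | hv | hv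
      · exact hS.1.trans hT.1.symm
      · exact ihl hS.2.1 hT.2.1 v hv
      · exact ihr hS.2.2 hT.2.2 v hv
  refine PlaneTree.ext hr (funext fun v => ?_)
  by_cases hv : v = S.root
  · rw [hv, ← S.roots_forest, h, T.roots_forest, hr]
  · exact key S.represents_forest (h ▸ T.represents_forest) v (mem_labels_forest.2 hv)

end Forest

variable {V : Type*} [Fintype V] [LinearOrder V] {T : PlaneTree V}

theorem beta_le {a b : V} (h : T.IsDescendant a b) : T.beta a ≤ b :=
  Finset.min'_le _ _ ((T.mem_descendants a b).2 h)

variable (T) in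
theorem isDescendant_beta (a : V) : T.IsDescendant a (T.beta a) :=
  (T.mem_descendants a _).1 (Finset.min'_mem _ _)

theorem coe_beta {a : V} {l : PlaneForest V} (ha : T.children a = l.roots)
    (hl : Represents T.children l) : (T.beta a : WithTop V) = treeLow a l := by
  refine le_antisymm ?_ ?_
  · obtain ⟨b, hb, h⟩ := exists_mem_treeLow_eq a l
    rw [h, WithTop.coe_le_coe]
    refine beta_le ((mem_labels_iff_isDescendant ha hl).1 ?_)
    rw [mem_labels_node]
    tauto
  · rw [← low_node_nil]
    exact low_le_of_mem ((mem_labels_iff_isDescendant ha hl).2 (T.isDescendant_beta a))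

theorem isElder_iff {v a : V} {s : List V} {l r : PlaneForest V}
    (hs : T.children v = s ++ (node a l r).roots) (hf : Represents T.children (node a l r)) :
    T.IsElder a ↔ r.low < treeLow a l := by
  obtain ⟨h1, h2, h3⟩ := hf
  rw [← coe_beta h1 h2]
  have ha : a ∈ T.children v := by simp [hs, roots]
  constructor
  · rintro ⟨u, k, hk, hlt⟩
    obtain rfl := T.parent_unique u v a (hk.subset (by simp)) ha
    have hn := T.nodup u
    rw [hs] at hk hn
    have hkr := List.mem_of_pair_sublist_append_cons hn hk
    exact (low_le_of_mem (h3.mem_labels_iff.2 ⟨k, hkr, T.isDescendant_beta k⟩)).trans_lt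
      (WithTop.coe_lt_coe.2 hlt)
  · intro h
    rcases exists_mem_low_eq r with h' | ⟨c, hc, h'⟩
    · simp [h'] at h
    · obtain ⟨k, hk, hkc⟩ := h3.mem_labels_iff.1 hc
      rw [h', WithTop.coe_lt_coe] at h
      refine ⟨v, k, ?_, (beta_le hkc).trans_lt h⟩
      rw [hs, roots]
      exact ((List.singleton_sublist.2 hk).cons_cons a).trans (List.sublist_append_right _ _)

/-- Since `v` is not a descendant of its child `a`, equality `T.beta a = v` cannot occur. -/
theorem isImproperEdge_iff {v a : V} (ha : a ∈ T.children v) :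
    T.IsImproperEdge v a ↔ ¬ T.IsElder a ∧ T.beta a < v := by
  have : T.beta a ≠ v := fun h => not_isDescendant_of_mem_children ha (h ▸ T.isDescendant_beta a)
  rw [IsImproperEdge, IsProperEdge, lt_iff_le_and_ne, ← not_lt]
  tauto

theorem exists_isImproperEdge_iff {v a : V} (ha : a ∈ T.children v) :
    (∃ u, T.IsImproperEdge u a) ↔ ¬ T.IsElder a ∧ T.beta a < v := by
  rw [← isImproperEdge_iff ha]
  exact ⟨fun ⟨u, hu⟩ => T.parent_unique u v a hu.1 ha ▸ hu, fun h => ⟨v, h⟩⟩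

section Weight

variable {R : Type*} [CommSemiring R]

open Classical in
/-- The weight of a vertex other than the root: `t` if it is elder, `y` if the edge to it is
improper, and otherwise `x` or `1`, according to whether it is a child of the root. -/
noncomputable def vertexWeight (T : PlaneTree V) (t y x : R) (j : V) : R :=
  if T.IsElder j then t else if ∃ i, T.IsImproperEdge i j then y else
    if j ∈ T.children T.root then x else 1

theorem weight_eq_prod (t y x : R) {f : PlaneForest V} {v : V} {s : List V}
    (hs : T.children v = s ++ f.roots) (hf : Represents T.children f) :
    weight t y (fun p => if p = T.root then x else 1) v f =
      (f.labels.map (T.vertexWeight t y x)).prod := by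
  induction f generalizing v s with
  | nil => simp [weight, labels]
  | node a l r ihl ihr =>
    have ha : a ∈ T.children v := by simp [hs, roots]
    have hroot : a ∈ T.children T.root ↔ v = T.root :=
      ⟨fun h => T.parent_unique _ _ _ ha h, fun h => h ▸ ha⟩
    rw [weight, labels, List.map_cons, List.map_append, List.prod_cons, List.prod_append,
      ihl (v := a) (s := []) hf.1 hf.2.1,
      ihr (v := v) (s := s ++ [a]) (by simpa [roots] using hs) hf.2.2, mul_assoc]
    congr 1
    have hlt : T.beta a < v ↔ treeLow a l < v := by
      rw [← coe_beta hf.1 hf.2.1, WithTop.coe_lt_coe]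
    simp only [edgeWeight, vertexWeight, exists_isImproperEdge_iff ha, isElder_iff hs hf, hlt, hroot]
    split_ifs <;> tauto

end Weight

theorem forest_toPlaneTree {p : V} {f : PlaneForest V} (hf : f.labels.Nodup)
    (hp : ∀ x, x ∈ f.labels ↔ x ≠ p) : (f.toPlaneTree p hf hp).forest = f := by
  refine (represents_forest _).unique ((represents_lookup hf).congr fun a ha => ?_) ?_
  · exact if_neg ((hp a).1 ha)
  · rw [roots_forest]
    exact if_pos rfl

open Classical in
theorem weight_forest {R : Type*} [CommSemiring R] (t y x : R) :
    weight t y (fun p => if p = T.root then x else 1) T.root T.forest =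
      ∏ j ∈ Finset.univ.erase T.root, T.vertexWeight t y x j := by
  rw [weight_eq_prod (s := []) t y x T.roots_forest.symm T.represents_forest,
    ← List.prod_toFinset _ T.nodup_labels_forest]
  refine Finset.prod_congr ?_ fun _ _ => rfl
  ext j
  simp [mem_labels_forest]

theorem not_isElder_root : ¬ T.IsElder T.root := by
  rintro ⟨v, k, h, -⟩
  exact T.root_notMem v (h.subset (by simp))

open Classical in
theorem numImproper_eq_card :
    T.numImproper = (Finset.univ.filter fun j => ∃ i, T.IsImproperEdge i j).card := by
  rw [numImproper]
  refine Finset.card_bij (fun e _ => e.2) ?_ ?_ ?_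
  · intro e he
    simp only [Finset.mem_filter, Finset.mem_univ, true_and] at he ⊢
    exact ⟨_, he⟩
  · intro e he e' he' h
    simp only [Finset.mem_filter, Finset.mem_univ, true_and] at he he'
    exact Prod.ext (T.parent_unique _ _ e.2 he.1 (h ▸ he'.1)) h
  · intro j hj
    simp only [Finset.mem_filter, Finset.mem_univ, true_and] at hj
    obtain ⟨i, hi⟩ := hj
    exact ⟨(i, j), by simpa using hi, rfl⟩

open Classical in
theorem young_eq_card (v : V) :
    T.young v = (Finset.univ.filter fun j => j ∈ T.children v ∧ ¬ T.IsElder j).card := by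
  have h1 : T.deg v = (Finset.univ.filter fun j => j ∈ T.children v).card := by
    rw [deg, ← List.toFinset_card_of_nodup (T.nodup v)]
    congr 1
    ext
    simp
  have h2 := Finset.card_filter_add_card_filter_not
    (s := Finset.univ.filter fun j => j ∈ T.children v) (fun j => T.IsElder j)
  rw [Finset.filter_filter, Finset.filter_filter] at h2
  rw [young, eldAt, h1]
  omega

-- As the root is the smallest label, its edges are never improper, so exactly its younger children
-- carry `x`.
open Classical in
theorem prod_vertexWeight {R : Type*} [CommSemiring R] (t y x : R)
    (hr : ∀ v, T.root ≤ v) :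
    ∏ j ∈ Finset.univ.erase T.root, T.vertexWeight t y x j =
      t ^ T.eld * y ^ T.numImproper * x ^ T.young T.root := by
  have h : ∀ j, (if j = T.root then 1 else T.vertexWeight t y x j) =
      ((if T.IsElder j then t else 1) * (if ∃ i, T.IsImproperEdge i j then y else 1)) *
        (if j ∈ T.children T.root ∧ ¬ T.IsElder j then x else 1) := by
    intro j
    by_cases hj : j = T.root
    · subst hj
      have h1 : ¬ ∃ i, T.IsImproperEdge i T.root := fun ⟨i, hi⟩ => T.root_notMem i hi.1
      simp [not_isElder_root, h1, T.root_notMem]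
    · rw [if_neg hj, vertexWeight]
      have h1 : (∃ i, T.IsImproperEdge i j) → ¬ T.IsElder j := by
        rintro ⟨i, hi⟩ he
        exact hi.2 ⟨hi.1, Or.inl he⟩
      have h2 : j ∈ T.children T.root → ¬ ∃ i, T.IsImproperEdge i j := by
        intro hj'
        rw [exists_isImproperEdge_iff hj']
        exact fun h => not_lt_of_ge (hr _) h.2
      by_cases he : T.IsElder j
      · have h3 : ¬ ∃ i, T.IsImproperEdge i j := fun h => h1 h he
        rw [if_pos he, if_pos he, if_neg h3, if_neg (by tauto)]
        simp
      · by_cases hi : ∃ i, T.IsImproperEdge i j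
        · rw [if_neg he, if_pos hi, if_neg he, if_pos hi, if_neg (by tauto)]
          simp
        · rw [if_neg he, if_neg hi, if_neg he, if_neg hi]
          simp [he]
  have h4 : ∏ j ∈ Finset.univ.erase T.root, T.vertexWeight t y x j =
      ∏ j, (if j = T.root then 1 else T.vertexWeight t y x j) := by
    rw [← Finset.mul_prod_erase Finset.univ _ (Finset.mem_univ T.root), if_pos rfl, one_mul]
    exact Finset.prod_congr rfl fun j hj => (if_neg (Finset.ne_of_mem_erase hj)).symm
  rw [h4, Finset.prod_congr rfl fun j _ => h j, Finset.prod_mul_distrib, Finset.prod_mul_distrib]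
  simp only [← Finset.prod_filter, Finset.prod_const]
  rw [eld, numImproper_eq_card, young_eq_card]

/-- The last child of the root has no brother to its right, so it is younger. -/
theorem one_le_young_root [Nontrivial V] : 1 ≤ T.young T.root := by
  classical
  obtain ⟨v, hv⟩ := exists_ne T.root
  have hne : T.children T.root ≠ [] := by
    intro h
    rcases Relation.ReflTransGen.cases_head_iff.1 (T.reachable v) with h' | ⟨c, hc, -⟩
    · exact hv h'.symm
    · simp [h] at hc
  rw [young_eq_card, Nat.one_le_iff_ne_zero, Finset.card_ne_zero]
  refine ⟨(T.children T.root).getLast hne, ?_⟩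
  simp only [Finset.mem_filter, Finset.mem_univ, true_and]
  refine ⟨List.getLast_mem hne, ?_⟩
  rintro ⟨u, k, hk, -⟩
  obtain rfl := T.parent_unique u T.root _ (hk.subset (by simp)) (List.getLast_mem hne)
  have hn := T.nodup T.root
  have hl := List.dropLast_append_getLast hne
  rw [← hl] at hn
  refine absurd (List.mem_of_pair_sublist_append_cons (b := k) hn ?_) (by simp)
  rwa [hl]

end PlaneTree

open PlaneForest in
open Classical in
theorem PlaneTree.sum_weight_forest {R : Type*} [CommSemiring R] (n : ℕ) (t y x : R) :
    ∑ T ∈ Finset.univ.filter (fun T : PlaneTree (Fin (n + 1)) => T.root = 0),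
        t ^ T.eld * y ^ T.numImproper * x ^ T.young 0 =
      ∑ f ∈ forests n, weight t y (fun p => if p = 0 then x else 1) 0 f := by
  refine Finset.sum_bij (fun T _ => T.forest.map Fin.val) ?_ ?_ ?_ ?_
  · intro T hT
    simp only [Finset.mem_filter, Finset.mem_univ, true_and] at hT
    rw [mem_forests, labels_map]
    refine ⟨T.nodup_labels_forest.map Fin.val_injective, fun a => ?_⟩
    simp only [List.mem_map, T.mem_labels_forest, hT]
    constructor
    · rintro ⟨v, hv, rfl⟩
      have := Fin.val_ne_zero_iff.2 hv
      omega
    · rintro ⟨h1, h2⟩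
      refine ⟨⟨a, by omega⟩, fun h => ?_, rfl⟩
      have := congrArg Fin.val h
      simp at this
      omega
  · intro S hS T hT h
    simp only [Finset.mem_filter, Finset.mem_univ, true_and] at hS hT
    exact forest_injective (hS.trans hT.symm) (map_injective Fin.val_injective h)
  · intro f hf
    obtain ⟨h1, h2⟩ := mem_forests.1 hf
    -- `Fin.ofNat` reduces modulo `n + 1`, which is harmless since all labels are at most `n`.
    have hmap : (f.map (Fin.ofNat (n + 1))).map Fin.val = f := by
      rw [map_map]
      refine map_eq_self fun a ha => ?_
      have := (h2 a).1 ha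
      simp only [Function.comp, Fin.ofNat]
      exact Nat.mod_eq_of_lt (by omega)
    have hlab : ∀ x : Fin (n + 1), x ∈ (f.map (Fin.ofNat (n + 1))).labels ↔ x ≠ 0 := by
      intro x
      rw [← List.mem_map_of_injective Fin.val_injective, ← labels_map, hmap, h2,
        ← Fin.val_ne_zero_iff]
      omega
    have hnd : (f.map (Fin.ofNat (n + 1))).labels.Nodup := by
      refine List.Nodup.of_map Fin.val ?_
      rwa [← labels_map, hmap]
    refine ⟨toPlaneTree 0 _ hnd hlab, by simp [toPlaneTree], ?_⟩
    rw [forest_toPlaneTree, hmap]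
  · intro T hT
    simp only [Finset.mem_filter, Finset.mem_univ, true_and] at hT
    have h := T.prod_vertexWeight t y x (fun v => hT ▸ Fin.zero_le v)
    rw [← weight_forest, hT] at h
    have hw := weight_map t y (fun p : ℕ => if p = 0 then x else 1) Fin.val_strictMono
      (0 : Fin (n + 1)) T.forest
    rw [Fin.val_zero] at hw
    rw [← h, hw]
    congr 1
    funext p
    simp only [Function.comp, Fin.val_eq_zero_iff]

/-! ### The recurrence for the generating polynomial -/

namespace PlaneForest

open Polynomial

/-- The weight is a constant times `X` to the number of improper edges, so it is an eigenvector of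
the Euler operator. -/
theorem X_mul_derivative_weight {S : Type*} [CommRing S] (t : S) (ω : ℕ → S) (p : ℕ)
    (f : PlaneForest ℕ) :
    X * derivative (weight (C t) X (fun v => C (ω v)) p f) =
      ((rootImproper p f + innerImproper f : ℕ) : S[X]) *
        weight (C t) X (fun v => C (ω v)) p f := by
  induction f generalizing p with
  | nil => simp [weight, rootImproper, innerImproper]
  | node a l r ihl ihr =>
    have h : X * derivative (edgeWeight (C t) X (C (ω p)) p (treeLow a l) r.low) =
        ((if treeLow a l < p ∧ ¬ r.low < treeLow a l then 1 else 0 : ℕ) : S[X]) *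
          edgeWeight (C t) X (C (ω p)) p (treeLow a l) r.low := by
      rw [edgeWeight]
      by_cases h1 : r.low < treeLow a l
      · simp [h1]
      · by_cases h2 : treeLow a l < p <;> simp [h1, h2]
    rw [weight, derivative_mul, derivative_mul]
    have e1 := ihl a
    have e2 := ihr p
    rw [rootImproper, innerImproper]
    push_cast at h e1 e2 ⊢
    linear_combination (weight (C t) X (fun v => C (ω v)) a l *
      weight (C t) X (fun v => C (ω v)) p r) * h +
      (edgeWeight (C t) X (C (ω p)) p (treeLow a l) r.low *
        weight (C t) X (fun v => C (ω v)) p r) * e1 +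
      (edgeWeight (C t) X (C (ω p)) p (treeLow a l) r.low *
        weight (C t) X (fun v => C (ω v)) a l) * e2

theorem rootImproper_zero (f : PlaneForest ℕ) : rootImproper 0 f = 0 := by
  induction f with
  | nil => rfl
  | node a l r _ ih =>
    rw [rootImproper, ih, if_neg]
    rintro ⟨h, -⟩
    exact not_lt_bot (α := WithTop ℕ) h

/-- The generating polynomial of the forests with labels `1, …, n` above the root `0`, where `X`
marks improper edges. -/
noncomputable def genPoly {S : Type*} [CommRing S] (t x : S) (n : ℕ) : S[X] :=
  ∑ f ∈ forests n, weight (C t) X (fun p => if p = 0 then C x else 1) 0 f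

theorem genPoly_zero {S : Type*} [CommRing S] (t x : S) : genPoly t x 0 = 1 := by
  simp [genPoly, forests, weight]

theorem genPoly_succ {S : Type*} [CommRing S] (t x : S) (n : ℕ) :
    genPoly t x (n + 1) = (C x + (n : S[X])) * genPoly t x n +
      (X + C t) * ((n : S[X]) * genPoly t x n + X * derivative (genPoly t x n)) := by
  have hω : (fun p : ℕ => if p = 0 then C x else 1) =
      fun p => C (if p = 0 then x else 1) := by
    funext p
    split_ifs <;> simp
  rw [genPoly, genPoly, sum_forests_succ, derivative_sum]
  simp only [Finset.mul_sum, ← Finset.sum_add_distrib]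
  refine Finset.sum_congr rfl fun f hf => ?_
  obtain ⟨h1, h2⟩ := mem_forests.1 hf
  have hlen : f.labels.length = n := by
    rw [← List.toFinset_card_of_nodup h1]
    have : f.labels.toFinset = Finset.Icc 1 n := by
      ext a
      simp [h2]
    rw [this, Nat.card_Icc, Nat.add_sub_cancel]
  have hsum : (f.labels.map fun p : ℕ => if p = 0 then C x else 1).sum = (n : S[X]) := by
    have : f.labels.map (fun p : ℕ => if p = 0 then C x else 1) =
        f.labels.map fun _ => (1 : S[X]) := by
      refine List.map_congr_left fun a ha => if_neg ?_
      have := (h2 a).1 ha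
      omega
    rw [this]
    simp [hlen]
  rw [sum_weight_ins _ _ _ (Nat.succ_pos n) (fun b hb => Nat.lt_succ_of_le ((h2 b).1 hb).2) h1,
    hsum, hlen, if_pos rfl]
  have hd := X_mul_derivative_weight t (fun p => if p = 0 then x else 1) 0 f
  rw [← hω, rootImproper_zero, zero_add] at hd
  rw [hd]
  ring

end PlaneForest

/-! ### Comparison with Q_n and extraction of coefficients -/

section Chapoton

open Polynomial

/-- Only y is sent to `X`, and the other variables to constants, so ∂_y becomes the derivative. -/
theorem aeval_pderiv_one (a b : MvPolynomial (Fin 2) ℤ) (p : MvPolynomial (Fin 4) ℤ) :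
    MvPolynomial.aeval ![C a, X, 1, C b] (MvPolynomial.pderiv 1 p) =
      derivative (MvPolynomial.aeval (R := ℤ) ![C a, X, 1, C b] p) := by
  induction p using MvPolynomial.induction_on with
  | C r => simp
  | add p q hp hq => simp [hp, hq]
  | mul_X p i h =>
    rw [Derivation.leibniz, map_mul, derivative_mul, map_add, smul_eq_mul, smul_eq_mul, map_mul,
      map_mul, h, MvPolynomial.pderiv_X, MvPolynomial.aeval_X]
    fin_cases i <;> simp <;> ring

theorem chapotonQy_add_two (n : ℕ) :
    chapotonQy (n + 2) = (C (MvPolynomial.X 0) + ((n + 1 : ℕ) : (MvPolynomial (Fin 2) ℤ)[X])) *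
        chapotonQy (n + 1) +
      (X + C (MvPolynomial.X 1)) * (((n + 1 : ℕ) : (MvPolynomial (Fin 2) ℤ)[X]) *
        chapotonQy (n + 1) + X * derivative (chapotonQy (n + 1))) := by
  simp only [chapotonQy, chapotonQ, map_add, map_mul, map_natCast, MvPolynomial.aeval_X,
    aeval_pderiv_one]
  simp

theorem X_mul_chapotonQy (n : ℕ) :
    C (MvPolynomial.X 0) * chapotonQy (n + 1) =
      PlaneForest.genPoly (MvPolynomial.X 1) (MvPolynomial.X 0) (n + 1) := by
  induction n with
  | zero =>
    rw [PlaneForest.genPoly_succ, PlaneForest.genPoly_zero]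
    simp [chapotonQy, chapotonQ]
  | succ n ih =>
    rw [PlaneForest.genPoly_succ, ← ih, chapotonQy_add_two, derivative_mul, derivative_C]
    ring

end Chapoton

theorem theorem2p1 (n k : ℕ) (hn : 1 ≤ n) :
    (∀ T ∈ planeTreesRootOne (n + 1) k, 1 ≤ T.young 0) ∧
    chapotonQcoeff n k =
      ∑ T ∈ planeTreesRootOne (n + 1) k,
        (MvPolynomial.X 0 : MvPolynomial (Fin 2) ℤ) ^ (T.young 0 - 1)
          * MvPolynomial.X 1 ^ T.eld := by
  classical
  have hroot : ∀ T : PlaneTree (Fin (n + 1)), (T.root : ℕ) = 0 ↔ T.root = 0 := fun T =>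
    Fin.val_eq_zero_iff
  have hyoung : ∀ T ∈ planeTreesRootOne (n + 1) k, 1 ≤ T.young 0 := by
    intro T hT
    have : Nontrivial (Fin (n + 1)) := Fin.nontrivial_iff_two_le.2 (by omega)
    have h := (hroot T).1 (Finset.mem_filter.1 hT).2.1
    exact h ▸ T.one_le_young_root
  refine ⟨hyoung, ?_⟩
  obtain ⟨m, rfl⟩ : ∃ m, n = m + 1 := ⟨n - 1, by omega⟩
  -- The forests count all younger children of the root; multiplying by x restores the one omitted
  -- in the exponent.
  refine mul_left_cancel₀ (MvPolynomial.X_ne_zero (R := ℤ) (0 : Fin 2)) ?_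
  have h := congrArg (fun q => Polynomial.coeff q k) (X_mul_chapotonQy m)
  rw [PlaneForest.genPoly, ← PlaneTree.sum_weight_forest] at h
  simp only [Polynomial.coeff_C_mul, Polynomial.finsetSum_coeff] at h
  rw [chapotonQcoeff, h, Finset.mul_sum, planeTreesRootOne, ← Finset.filter_filter]
  conv_rhs => rw [Finset.sum_filter]
  simp only [hroot]
  refine Finset.sum_congr rfl fun T hT => ?_
  rw [mul_assoc, ← Polynomial.C_pow, ← Polynomial.C_pow, Polynomial.coeff_C_mul,
    Polynomial.coeff_mul_C, Polynomial.coeff_X_pow]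
  split_ifs with h1 h2 h2
  -- The truncated subtraction is exact because the root has a younger child.
  · have h3 : T.young 0 = T.young 0 - 1 + 1 :=
      (Nat.sub_add_cancel (hyoung T (Finset.mem_filter.2 ⟨Finset.mem_univ _,
        (hroot T).2 (Finset.mem_filter.1 hT).2, h1.symm⟩))).symm
    conv_lhs => rw [h3, pow_succ]
    ring
  · exact absurd h1.symm h2
  · exact absurd h2.symm h1
  · simp
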